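/- **Theorem 3.** Let $D$ be a division ring with centre $C$, of finite dimension $d^2$ over $C$, and let $\sigma$ be a ring automorphism of $D$ of finite inner order $n\ge 1$: there is $u\in D^\times$ with $\sigma^n=\iota_u$, where $\iota_u(a)=uau^{-1}$, and $\sigma^i$ is not an inner automorphism for $1\le i<n$. Let $u$ be chosen so that moreover $\sigma(u)=u$. Put $F=C\cap\mathrm{Fix}(\sigma)$, and let $R=D[t;\sigma]$ be the skew polynomial ring, in which $ta=\sigma(a)t$ for $a\in D$; then $u^{-1}t^n$ lies in the centre $C(R)$ of $R$. Let $f\in R$ be monic of degree $m\ge 1$ such that the greatest common right divisor of $f$ and $t$ is $1$. Let $h=\hat h(u^{-1}t^n)$, with $\hat h\in F[x]$ monic, be the minimal central left multiple of $f$, i.e. $h\in C(R)\cap Rf$ and $h$ has minimal degree among the nonzero elements of $C(R)\cap Rf$. Let $\mathcal E(f)=\{g\in R: fg\in Rf\}/Rf$ be the eigenring of $f$, an $F$-algebra, and call $f$ a generalised A-polynomial if $\mathcal E(f)$ is a (finite-dimensional) central simple algebra over $F$. Suppose that $\hat h$ is irreducible in $F[x]$. Then the following are equivalent: 1. $f$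 is a generalised A-polynomial; 2. $\hat h(x)=x-a$ for some $a\in F$; 3. $f$ right divides $u^{-1}t^n-a$ in $R$ (that is, $u^{-1}t^n-a\in Rf$) for some $a\in F$. In particular, if $f$ is a generalised A-polynomial, then $m\le n$. -/

import Mathlib

/-!
Skew polynomial rings `R = D[t; σ]` over a division ring `D`. The ring is Mathlib's
`SkewPolynomial D`; its twist `σ` is `SkewPolynomial.φ`, so that `t * a = σ(a) * t`.
-/

noncomputable section

namespace SkewEigen

section Inner

variable {D : Type*} [DivisionRing D]

/-- `τ` is the inner automorphism `ι_u : a ↦ u a u⁻¹`. -/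
def IsInnerBy (τ : D → D) (u : Dˣ) : Prop :=
  ∀ a : D, τ a = (u : D) * a * ((u⁻¹ : Dˣ) : D)

/-- `σ` has finite inner order `n`, with `σⁿ = ι_u`: `n` is positive, `σⁿ` is conjugation by `u`,
and no `σⁱ` with `1 ≤ i < n` is inner. -/
structure HasInnerOrder (σ : D ≃+* D) (n : ℕ) (u : Dˣ) : Prop where
  pos : 0 < n
  pow_eq : IsInnerBy (⇑σ)^[n] u
  not_inner : ∀ i : ℕ, 1 ≤ i → i < n → ∀ v : Dˣ, ¬ IsInnerBy (⇑σ)^[i] v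

end Inner

variable (D : Type*) [DivisionRing D] [MulSemiringAction (Multiplicative ℕ) D]

/-- The field `F = C ∩ Fix(σ)`, as a subfield of the centre `C` of `D`. -/
def fixedCenter : Subfield (Subring.center D) where
  carrier := {c | SkewPolynomial.φ (c : D) = c}
  mul_mem' {a b} ha hb := by
    simp only [Set.mem_ofPred_eq] at ha hb ⊢
    rw [Subring.coe_mul, map_mul, ha, hb]
  one_mem' := by simp
  add_mem' {a b} ha hb := by
    simp only [Set.mem_ofPred_eq] at ha hb ⊢
    rw [Subring.coe_add, map_add, ha, hb]
  zero_mem' := by simp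
  neg_mem' {a} ha := by
    simp only [Set.mem_ofPred_eq] at ha ⊢
    rw [Subring.coe_neg, map_neg, ha]
  inv_mem' a ha := by
    simp only [Set.mem_ofPred_eq] at ha ⊢
    have h : ((a⁻¹ : Subring.center D) : D) = (a : D)⁻¹ := by
      exact map_inv₀ (Subring.center D).subtype a
    rw [h, map_inv₀, ha]

/-- The field `F = C ∩ Fix(σ)` as a type. -/
def BaseField : Type _ := fixedCenter D

instance baseFieldField : Field (BaseField D) := inferInstanceAs (Field (fixedCenter D))

/-- `D` is an `F`-algebra through the inclusion `F ⊆ C ⊆ D`. -/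
instance baseFieldAlgebra : Algebra (BaseField D) D :=
  inferInstanceAs (Algebra (fixedCenter D) D)

theorem algebraMap_baseField (c : fixedCenter D) :
    algebraMap (BaseField D) D c = ((c : Subring.center D) : D) := rfl

/-- Elements of `F` are fixed by `σ`; this makes `D[t; σ]` an `F`-algebra. -/
instance baseField_smulCommClass : SMulCommClass (Multiplicative ℕ) (BaseField D) D where
  smul_comm m c x := by
    have hm := Function.iterate_fixed c.2 (Multiplicative.toAdd m)
    rw [SkewPolynomial.φ_iterate_apply, ofAdd_toAdd] at hm
    rw [Algebra.smul_def, Algebra.smul_def, smul_mul']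
    exact congrArg (· * (m • x)) hm

variable {D}

/-- The degree of a skew polynomial (`0` for the zero polynomial). -/
def natDegree (p : SkewPolynomial D) : ℕ := p.support.sup id

/-- A skew polynomial is monic if its leading coefficient is `1`. -/
def IsMonic (p : SkewPolynomial D) : Prop := p.coeff (natDegree p) = 1

/-- `e` is the (monic) greatest common right divisor of `f` and `g`. Here `RightDvd a b` (also
written `a ∣ᵣ b`) means `b = q a` for some `q`. -/
structure IsGCRD (e f g : SkewPolynomial D) : Prop where
  monic : IsMonic e
  dvd_left : RightDvd e f
  dvd_right : RightDvd e g
  greatest : ∀ e' : SkewPolynomial D, RightDvd e' f → RightDvd e' g → RightDvd e' e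

/-- The left ideal `R f`. -/
abbrev leftIdeal (f : SkewPolynomial D) : Ideal (SkewPolynomial D) := Ideal.span {f}

/-- The idealiser `I(f) = {g ∈ R : f g ∈ R f}`, as an `F`-subalgebra of `R`. -/
def idealiser (f : SkewPolynomial D) : Subalgebra (BaseField D) (SkewPolynomial D) where
  carrier := {g | f * g ∈ leftIdeal f}
  mul_mem' {a b} ha hb := by
    simp only [Set.mem_ofPred_eq] at ha hb ⊢
    obtain ⟨q, hq⟩ := Ideal.mem_span_singleton'.1 ha
    rw [← mul_assoc, ← hq, mul_assoc]
    exact Ideal.mul_mem_left _ _ hb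
  add_mem' {a b} ha hb := by
    simp only [Set.mem_ofPred_eq] at ha hb ⊢
    rw [mul_add]
    exact Ideal.add_mem _ ha hb
  algebraMap_mem' r := by
    simp only [Set.mem_ofPred_eq]
    rw [← Algebra.commutes]
    exact Ideal.mul_mem_left _ _ (Ideal.mem_span_singleton_self f)

/-- `R f` as a left ideal of `I(f)`. -/
def idealiserIdeal (f : SkewPolynomial D) : Ideal (idealiser f) :=
  (leftIdeal f).comap (idealiser f).val

instance idealiserIdeal_isTwoSided (f : SkewPolynomial D) :
    (idealiserIdeal f).IsTwoSided where
  mul_mem_of_left {a} b ha := by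
    obtain ⟨q, hq⟩ := Ideal.mem_span_singleton'.1 (Ideal.mem_comap.1 ha)
    refine Ideal.mem_comap.2 ?_
    rw [map_mul, ← hq, mul_assoc]
    exact Ideal.mul_mem_left _ _ b.2

/-- The eigenring `E(f) = I(f) / R f`, an `F`-algebra. -/
def Eigenring (f : SkewPolynomial D) : Type _ := idealiser f ⧸ idealiserIdeal f

instance eigenringRing (f : SkewPolynomial D) : Ring (Eigenring f) :=
  inferInstanceAs (Ring (idealiser f ⧸ idealiserIdeal f))

instance eigenringAlgebra (f : SkewPolynomial D) : Algebra (BaseField D) (Eigenring f) :=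
  Ideal.Quotient.algebra (BaseField D)

/-- `f` is a generalised A-polynomial: `E(f)` is a (finite-dimensional) central simple algebra
over `F`. -/
structure IsGeneralisedAPolynomial (f : SkewPolynomial D) : Prop where
  central : Algebra.IsCentral (BaseField D) (Eigenring f)
  simple : IsSimpleRing (Eigenring f)
  finite : FiniteDimensional (BaseField D) (Eigenring f)

/-- The element `u⁻¹ tⁿ` of `R`. -/
def centralVar (u : Dˣ) (n : ℕ) : SkewPolynomial D :=
  SkewPolynomial.C ((u⁻¹ : Dˣ) : D) * SkewPolynomial.X ^ n

/-- `h = ĥ(u⁻¹ tⁿ)`, with `ĥ ∈ F[x]` monic, is the minimal central left multiple of `f`: it is a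
central left multiple of `f`, and has minimal degree among the nonzero central left multiples. -/
structure IsMinCentralLeftMultiple (u : Dˣ) (n : ℕ) (f : SkewPolynomial D)
    (hhat : Polynomial (BaseField D)) : Prop where
  monic : hhat.Monic
  central : Polynomial.aeval (centralVar u n) hhat ∈ Subring.center (SkewPolynomial D)
  dvd : RightDvd f (Polynomial.aeval (centralVar u n) hhat)
  minimal : ∀ h' ∈ Subring.center (SkewPolynomial D), h' ≠ 0 → RightDvd f h' →
    natDegree (Polynomial.aeval (centralVar u n) hhat) ≤ natDegree h'

end SkewEigen

end

/-!
For nonzero `a ∈ F` the central element `u⁻¹tⁿ - a` generates a two-sided ideal, and the quotient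
`A = R / R(u⁻¹tⁿ - a)` is a central simple `F`-algebra: since no `σⁱ` with `1 ≤ i < n` is inner, a
shortest nonzero element of a two-sided ideal, written in degree less than `n`, is a monomial, and
`t` is a unit of `A`. If `f` right divides `u⁻¹tⁿ - a`, then `Rf/R(u⁻¹tⁿ - a)` is the left
annihilator of an idempotent `e` of the semisimple ring `A`, so `ℰ(f) ≅ eAe` is again central
simple. The case `a = 0` cannot occur, because `f` is right coprime to `t` and hence to `tⁿ`.

Conversely the image of the central element `u⁻¹tⁿ` lies in the centre of `ℰ(f)`. If this centre is
`F`, the image is some `a ∈ F`, so `f` right divides both `u⁻¹tⁿ - a` and `ĥ(u⁻¹tⁿ)`; an irreducible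
`ĥ ≠ x - a` would be coprime to `x - a`, which would make `f` a unit.
-/

noncomputable section

namespace SkewEigen

open SkewPolynomial

section CornerRing

variable {A : Type*} [Ring A] {e : A}

/-- The inclusion of the corner ring `eAe` into `A`, which sends `1` to `e`. -/
def cornerSubtype (he : IsIdempotentElem e) : he.Corner →ₙ+* A where
  toFun := Subtype.val
  map_mul' _ _ := rfl
  map_zero' := rfl
  map_add' _ _ := rfl

/-- The Peirce compression `a ↦ e a e` of a ring onto the corner ring of an idempotent. -/
def toCorner (he : IsIdempotentElem e) (a : A) : he.Corner := ⟨e * a * e, a, rfl⟩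

variable {he : IsIdempotentElem e}

@[simp]
theorem cornerSubtype_toCorner (a : A) : cornerSubtype he (toCorner he a) = e * a * e := rfl

@[simp]
theorem cornerSubtype_one : cornerSubtype he 1 = e := rfl

theorem cornerSubtype_injective : Function.Injective (cornerSubtype he) := Subtype.val_injective

theorem idempotent_mul_cornerSubtype (x : he.Corner) :
    e * cornerSubtype he x = cornerSubtype he x :=
  ((Subsemigroup.mem_corner_iff he).1 x.2).1

theorem cornerSubtype_mul_idempotent (x : he.Corner) :
    cornerSubtype he x * e = cornerSubtype he x :=
  ((Subsemigroup.mem_corner_iff he).1 x.2).2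

theorem exists_isIdempotentElem_forall_mem_iff [IsSemisimpleRing A] (I : Ideal A) :
    ∃ e, IsIdempotentElem e ∧ ∀ x, x ∈ I ↔ x * e = 0 := by
  obtain ⟨e, he, rfl⟩ := IsSemisimpleRing.ideal_eq_span_idempotent I
  refine ⟨1 - e, he.one_sub, fun x ↦ ?_⟩
  rw [mul_sub, mul_one, sub_eq_zero, Ideal.mem_span_singleton']
  constructor
  · rintro ⟨y, rfl⟩
    rw [mul_assoc, he.eq]
  · exact fun hx ↦ ⟨x, hx.symm⟩

theorem exists_sum_mul_mul_eq_one [IsSimpleRing A] {x : A} (hx : x ≠ 0) :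
    ∃ (ι : Type) (_ : Fintype ι) (a b : ι → A), ∑ i, a i * x * b i = 1 := by
  have h1 : (1 : A) ∈ TwoSidedIdeal.span {x} :=
    IsSimpleRing.one_mem_of_ne_zero_mem _ hx (TwoSidedIdeal.subset_span rfl)
  rw [TwoSidedIdeal.mem_span_iff_mem_addSubgroup_closure] at h1
  generalize (1 : A) = y at h1 ⊢
  induction h1 using AddSubgroup.closure_induction with
  | mem y hy =>
    obtain ⟨_, ⟨a, -, _, rfl, rfl⟩, b, -, rfl⟩ := hy
    exact ⟨Unit, inferInstance, fun _ ↦ a, fun _ ↦ b, by simp⟩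
  | zero => exact ⟨Empty, inferInstance, Empty.elim, Empty.elim, by simp⟩
  | add y z _ _ hy hz =>
    obtain ⟨ι, _, a, b, rfl⟩ := hy
    obtain ⟨κ, _, a', b', rfl⟩ := hz
    exact ⟨ι ⊕ κ, inferInstance, Sum.elim a a', Sum.elim b b', by simp⟩
  | neg y _ hy =>
    obtain ⟨ι, _, a, b, rfl⟩ := hy
    exact ⟨ι, inferInstance, fun i ↦ -a i, b, by simp⟩

theorem isSimpleRing_corner [IsSimpleRing A] (he : IsIdempotentElem e) (he0 : e ≠ 0) :
    IsSimpleRing he.Corner := by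
  have : Nontrivial he.Corner := ⟨1, 0, fun h ↦ he0 (congrArg (cornerSubtype he) h)⟩
  refine .of_eq_bot_or_eq_top fun J ↦ ?_
  rw [or_iff_not_imp_left, ← J.one_mem_iff]
  intro hJ
  obtain ⟨x, hxJ, hx0 : x ≠ 0⟩ := SetLike.exists_of_lt (bot_lt_iff_ne_bot.2 hJ)
  obtain ⟨ι, _, a, b, hab⟩ :=
    exists_sum_mul_mul_eq_one ((map_ne_zero_iff _ (cornerSubtype_injective (he := he))).2 hx0)
  have hsum : ∑ i, toCorner he (a i) * x * toCorner he (b i) = 1 := by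
    apply cornerSubtype_injective
    calc cornerSubtype he (∑ i, toCorner he (a i) * x * toCorner he (b i))
        = ∑ i, e * a i * (e * cornerSubtype he x * e) * b i * e := by
          simp only [map_sum, map_mul, cornerSubtype_toCorner, mul_assoc]
      _ = e * (∑ i, a i * cornerSubtype he x * b i) * e := by
          simp only [idempotent_mul_cornerSubtype, cornerSubtype_mul_idempotent, Finset.sum_mul,
            Finset.mul_sum, mul_assoc]
      _ = e := by rw [hab, mul_one, he.eq]
  rw [← hsum]
  exact sum_mem fun i _ ↦ J.mul_mem_right _ _ (J.mul_mem_left _ _ hxJ)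

theorem exists_mem_center_mul_eq_of_mem_center_corner [IsSimpleRing A] (he0 : e ≠ 0)
    {z : he.Corner} (hz : z ∈ Subring.center he.Corner) :
    ∃ w ∈ Subring.center A, cornerSubtype he z = w * e := by
  obtain ⟨ι, _, a, b, hab⟩ := exists_sum_mul_mul_eq_one he0
  set s := cornerSubtype he z with hs
  have hcomm (y : A) : s * y * e = e * y * s := by
    calc s * y * e = s * (e * y * e) := by
          rw [← mul_assoc, ← mul_assoc, hs, cornerSubtype_mul_idempotent]
      _ = e * y * e * s := by
          have h := congrArg (cornerSubtype he) (Subring.mem_center_iff.1 hz (toCorner he y))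
          simpa using h.symm
      _ = e * y * s := by rw [mul_assoc, hs, idempotent_mul_cornerSubtype]
  -- A central `w` with `w * e = z` must be `w * ∑ i, aᵢ * e * bᵢ = ∑ i, aᵢ * z * bᵢ`.
  let w : A := ∑ i, a i * s * b i
  have hwe (y : A) : w * (y * e) = y * s := by
    calc w * (y * e) = ∑ i, a i * (s * (b i * y) * e) := by
          simp only [w, Finset.sum_mul, mul_assoc]
      _ = (∑ i, a i * e * b i) * (y * s) := by
          simp only [hcomm, Finset.sum_mul, mul_assoc]
      _ = y * s := by rw [hab, one_mul]
  refine ⟨w, Subring.mem_center_iff.2 fun y ↦ ?_, ?_⟩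
  · calc y * w = ∑ i, y * a i * s * b i := by simp only [w, Finset.mul_sum, mul_assoc]
      _ = ∑ i, w * (y * a i * e) * b i := by simp only [hwe]
      _ = w * y * ∑ i, a i * e * b i := by simp only [Finset.mul_sum, mul_assoc]
      _ = w * y := by rw [hab, mul_one]
  · simpa using (hwe 1).symm

end CornerRing

section Ring

theorem isTwoSided_span_singleton_of_mem_center {A : Type*} [Ring A] {g : A}
    (hg : g ∈ Subring.center A) : (Ideal.span {g}).IsTwoSided where
  mul_mem_of_left {x} y hx := by
    obtain ⟨z, rfl⟩ := Ideal.mem_span_singleton'.1 hx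
    rw [mul_assoc, ← Subring.mem_center_iff.1 hg y, ← mul_assoc]
    exact Ideal.mul_mem_left _ _ (Ideal.mem_span_singleton_self g)

theorem eq_X_sub_C_iff_sub_algebraMap_mem {F A : Type*} [Field F] [Ring A] [Algebra F A]
    {I : Ideal A} (hI : I ≠ ⊤) {p : Polynomial F} (hmonic : p.Monic) (hirr : Irreducible p)
    {z : A} (hp : Polynomial.aeval z p ∈ I) (a : F) :
    p = Polynomial.X - Polynomial.C a ↔ z - algebraMap F A a ∈ I := by
  have haeval : Polynomial.aeval z (Polynomial.X - Polynomial.C a) = z - algebraMap F A a := by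
    rw [map_sub, Polynomial.aeval_X, Polynomial.aeval_C]
  rw [← haeval]
  refine ⟨fun h ↦ h ▸ hp, fun ha ↦ ?_⟩
  by_cases hdvd : p ∣ Polynomial.X - Polynomial.C a
  · exact Polynomial.eq_of_monic_of_associated hmonic (Polynomial.monic_X_sub_C a)
      (hirr.associated_of_dvd (Polynomial.irreducible_X_sub_C a) hdvd)
  · obtain ⟨r, s, hrs⟩ := hirr.coprime_iff_not_dvd.2 hdvd
    have h := congrArg (Polynomial.aeval z) hrs
    rw [map_add, map_mul, map_mul, map_one] at h
    refine absurd ((Ideal.eq_top_iff_one I).2 ?_) hI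
    rw [← h]
    exact add_mem (I.mul_mem_left _ hp) (I.mul_mem_left _ ha)

end Ring

section Coefficients

open Finset.HasAntidiagonal (antidiagonal mem_antidiagonal)

variable {R : Type*} [Semiring R]

variable (R) in
/-- The skew polynomials of degree less than `n`, including zero. -/
def degreeLT (n : ℕ) : Submodule R (SkewPolynomial R) where
  carrier := {p | ∀ i, n ≤ i → p.coeff i = 0}
  add_mem' hp hq i hi := by rw [SkewPolynomial.coeff_add, hp i hi, hq i hi, add_zero]
  zero_mem' _ _ := rfl
  smul_mem' c _ hp i hi := (congrArg (c • ·) (hp i hi)).trans (smul_zero c)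

theorem degreeLT_mono {m n : ℕ} (h : m ≤ n) : degreeLT R m ≤ degreeLT R n :=
  fun _ hp i hi ↦ hp i (h.trans hi)

variable [MulSemiringAction (Multiplicative ℕ) R]

theorem coeff_mul_eq_sum (p q : SkewPolynomial R) (k : ℕ) :
    (p * q).coeff k =
      ∑ x ∈ antidiagonal k, p.coeff x.1 * φ^[x.1] (q.coeff x.2) := by
  simp only [φ_iterate_apply]
  exact SkewMonoidAlgebra.coeff_mul_antidiagonal_of_finset p q (Multiplicative.ofAdd k)
    (antidiagonal (A := ℕ) k) (mem_antidiagonal (A := ℕ))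

theorem coeff_monomial_mul_add (k i : ℕ) (a : R) (p : SkewPolynomial R) :
    (monomial k a * p).coeff (k + i) = a * φ^[k] (p.coeff i) := by
  rw [coeff_mul_eq_sum, Finset.sum_eq_single (k, i)]
  · simp [coeff_monomial]
  · rintro ⟨i', j⟩ hij hne
    have hk : k ≠ i' := by grind [mem_antidiagonal]
    simp [coeff_monomial, hk]
  · simp

theorem coeff_C_mul (a : R) (p : SkewPolynomial R) (i : ℕ) :
    (C a * p).coeff i = a * p.coeff i := by
  simpa using coeff_monomial_mul_add 0 i a p

theorem coeff_mul_C (p : SkewPolynomial R) (a : R) (i : ℕ) :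
    (p * C a).coeff i = p.coeff i * φ^[i] a := by
  rw [coeff_mul_eq_sum, Finset.sum_eq_single (i, 0)]
  · simp
  · rintro ⟨i', j⟩ hij hne
    have hj : j ≠ 0 := by grind [mem_antidiagonal]
    simp only [coeff_C_ne_zero hj, iterate_map_zero, mul_zero]
  · simp

theorem X_pow_mul_C (k : ℕ) (a : R) : (X ^ k * C a : SkewPolynomial R) = C (φ^[k] a) * X ^ k := by
  rw [← monomial_zero_left, X_pow_mul_monomial, zero_add, C_mul_X_pow_eq_monomial]

theorem C_mul_mem_degreeLT {n : ℕ} {p : SkewPolynomial R} (hp : p ∈ degreeLT R n) (a : R) :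
    C a * p ∈ degreeLT R n :=
  fun i hi ↦ by rw [coeff_C_mul, hp i hi, mul_zero]

theorem mul_C_mem_degreeLT {n : ℕ} {p : SkewPolynomial R} (hp : p ∈ degreeLT R n) (a : R) :
    p * C a ∈ degreeLT R n :=
  fun i hi ↦ by rw [coeff_mul_C, hp i hi, zero_mul]

theorem exists_eq_mul_X_add_C (p : SkewPolynomial R) : ∃ q, p = q * X + C (p.coeff 0) := by
  induction p using SkewPolynomial.induction with
  | h0 => exact ⟨0, by simp⟩
  | ha k a p _ _ ih =>
    obtain ⟨q, hq⟩ := ih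
    cases k with
    | zero =>
      refine ⟨q, ?_⟩
      nth_rewrite 1 [hq]
      simp [add_comm, add_left_comm]
    | succ k =>
      refine ⟨monomial k a + q, ?_⟩
      rw [add_mul, monomial_mul_X, SkewPolynomial.coeff_add, coeff_monomial_succ, zero_add,
        add_assoc, ← hq]

end Coefficients

instance finite_degreeLT {R : Type*} [Ring R] [IsNoetherianRing R] (n : ℕ) :
    Module.Finite R (degreeLT R n) := by
  let coeffs : degreeLT R n →ₗ[R] Fin n → R :=
    { toFun p i := coeff (p : SkewPolynomial R) i
      map_add' _ _ := funext fun _ ↦ SkewPolynomial.coeff_add ..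
      map_smul' _ _ := rfl }
  refine Module.Finite.of_injective coeffs fun p q hpq ↦ Subtype.ext ?_
  ext i
  rcases lt_or_ge i n with hi | hi
  · exact congrFun hpq ⟨i, hi⟩
  · exact (p.2 i hi).trans (q.2 i hi).symm

section Division

open Finset.HasAntidiagonal (mem_antidiagonal)

variable {D : Type*} [DivisionRing D]

theorem le_natDegree_of_coeff_ne_zero {p : SkewPolynomial D} {k : ℕ} (h : p.coeff k ≠ 0) :
    k ≤ natDegree p :=
  Finset.le_sup (f := id) (mem_support_iff.2 h)

theorem coeff_eq_zero_of_natDegree_lt {p : SkewPolynomial D} {k : ℕ} (h : natDegree p < k) :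
    p.coeff k = 0 :=
  of_not_not fun hk ↦ (le_natDegree_of_coeff_ne_zero hk).not_gt h

theorem mem_degreeLT_natDegree_succ (p : SkewPolynomial D) : p ∈ degreeLT D (natDegree p + 1) :=
  fun _ ↦ coeff_eq_zero_of_natDegree_lt

theorem coeff_natDegree_ne_zero {p : SkewPolynomial D} (hp : p ≠ 0) :
    p.coeff (natDegree p) ≠ 0 := by
  obtain ⟨i, hi, h⟩ := Finset.exists_mem_eq_sup p.support
    (Finset.nonempty_iff_ne_empty.2 (mt support_eq_empty.1 hp)) id
  rw [natDegree, h]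
  exact mem_support_iff.1 hi

variable [MulSemiringAction (Multiplicative ℕ) D]

theorem mem_leftIdeal_iff {f g : SkewPolynomial D} : g ∈ leftIdeal f ↔ f ∣ᵣ g :=
  Ideal.mem_span_singleton'.trans (exists_congr fun _ ↦ eq_comm)

theorem iterate_φ_ne_zero (k : ℕ) {a : D} (ha : a ≠ 0) : φ^[k] a ≠ 0 := by
  rw [← RingHom.coe_pow]
  exact (map_ne_zero _).2 ha

theorem coeff_mul_natDegree_add (p q : SkewPolynomial D) :
    (p * q).coeff (natDegree p + natDegree q) =
      p.coeff (natDegree p) * φ^[natDegree p] (q.coeff (natDegree q)) := by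
  rw [coeff_mul_eq_sum, Finset.sum_eq_single (natDegree p, natDegree q)]
  · rintro ⟨i, j⟩ hij hne
    obtain h | h : natDegree p < i ∨ natDegree q < j := by grind [mem_antidiagonal]
    · simp only [coeff_eq_zero_of_natDegree_lt h, zero_mul]
    · simp only [coeff_eq_zero_of_natDegree_lt h, iterate_map_zero, mul_zero]
  · simp

theorem coeff_mul_natDegree_add_ne_zero {p q : SkewPolynomial D} (hp : p ≠ 0) (hq : q ≠ 0) :
    (p * q).coeff (natDegree p + natDegree q) ≠ 0 := by
  rw [coeff_mul_natDegree_add]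
  exact mul_ne_zero (coeff_natDegree_ne_zero hp)
    (iterate_φ_ne_zero _ (coeff_natDegree_ne_zero hq))

theorem eq_zero_of_mem_leftIdeal_of_mem_degreeLT {g p : SkewPolynomial D} (hp : p ∈ leftIdeal g)
    (hdeg : p ∈ degreeLT D (natDegree g)) : p = 0 := by
  obtain ⟨q, rfl⟩ := Ideal.mem_span_singleton'.1 hp
  by_contra! h
  obtain ⟨hq, hg⟩ : q ≠ 0 ∧ g ≠ 0 := ⟨left_ne_zero_of_mul h, right_ne_zero_of_mul h⟩
  exact coeff_mul_natDegree_add_ne_zero hq hg (hdeg _ (Nat.le_add_left _ _))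

theorem natDegree_le_of_rightDvd {f g : SkewPolynomial D} (hg : g ≠ 0) (h : f ∣ᵣ g) :
    natDegree f ≤ natDegree g := by
  by_contra! hlt
  exact hg (eq_zero_of_mem_leftIdeal_of_mem_degreeLT (mem_leftIdeal_iff.2 h)
    (degreeLT_mono hlt (mem_degreeLT_natDegree_succ g)))

theorem not_rightDvd_one {f : SkewPolynomial D} (hf : 1 ≤ natDegree f) : ¬ f ∣ᵣ 1 := by
  intro h
  have h1 : (1 : SkewPolynomial D) ∈ degreeLT D (natDegree f) :=
    fun i hi ↦ by rw [← C_1, coeff_C_ne_zero (by omega)]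
  exact one_ne_zero (eq_zero_of_mem_leftIdeal_of_mem_degreeLT (mem_leftIdeal_iff.2 h) h1)

theorem exists_mem_degreeLT_sub_mem_leftIdeal {g : SkewPolynomial D} (hg : g ≠ 0)
    (p : SkewPolynomial D) : ∃ r ∈ degreeLT D (natDegree g), p - r ∈ leftIdeal g := by
  suffices h : ∀ N, ∀ p ∈ degreeLT D N, ∃ r ∈ degreeLT D (natDegree g), p - r ∈ leftIdeal g from
    h _ p (mem_degreeLT_natDegree_succ p)
  intro N
  induction N with
  | zero => exact fun p hp ↦ ⟨p, degreeLT_mono (Nat.zero_le _) hp, by simp⟩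
  | succ N ih =>
    intro p hp
    rcases lt_or_ge N (natDegree g) with hN | hN
    · exact ⟨p, degreeLT_mono hN hp, by simp⟩
    obtain ⟨k, rfl⟩ := Nat.exists_eq_add_of_le' hN
    let q := monomial k (p.coeff (k + natDegree g) * (φ^[k] (g.coeff (natDegree g)))⁻¹) * g
    have hq : p - q ∈ degreeLT D (k + natDegree g) := by
      intro i hi
      obtain ⟨j, rfl⟩ := Nat.exists_eq_add_of_le hi
      rw [SkewPolynomial.coeff_sub, add_assoc, coeff_monomial_mul_add]
      rcases Nat.eq_zero_or_pos j with rfl | hj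
      · rw [add_zero, inv_mul_cancel_right₀
          (iterate_φ_ne_zero _ (coeff_natDegree_ne_zero hg)), sub_self]
      · rw [← add_assoc, hp _ (by omega), coeff_eq_zero_of_natDegree_lt (by omega : _ < _ + j),
          iterate_map_zero, mul_zero, sub_zero]
    obtain ⟨r, hr, hpr⟩ := ih _ hq
    refine ⟨r, hr, ?_⟩
    have hqg : q ∈ leftIdeal g := Ideal.mul_mem_left _ _ (Ideal.mem_span_singleton_self g)
    rw [← sub_add_cancel p q, add_sub_right_comm]
    exact add_mem hpr hqg

theorem finite_quotient_leftIdeal {g : SkewPolynomial D} (hg : g ≠ 0) :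
    Module.Finite D (SkewPolynomial D ⧸ leftIdeal g) := by
  refine Module.Finite.of_surjective
    ((leftIdeal g).mkQ.restrictScalars D ∘ₗ (degreeLT D (natDegree g)).subtype) fun x ↦ ?_
  obtain ⟨p, rfl⟩ := Submodule.Quotient.mk_surjective _ x
  obtain ⟨r, hr, hpr⟩ := exists_mem_degreeLT_sub_mem_leftIdeal hg p
  exact ⟨⟨r, hr⟩, ((Submodule.Quotient.eq _).2 hpr).symm⟩

theorem coeff_zero_ne_zero_of_isGCRD_one_X {f : SkewPolynomial D} (hf : IsGCRD 1 f X) :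
    f.coeff 0 ≠ 0 := by
  intro h0
  obtain ⟨q, hq⟩ := exists_eq_mul_X_add_C f
  rw [h0, C_0, add_zero] at hq
  exact not_rightDvd_one (le_natDegree_of_coeff_ne_zero (by simp))
    (hf.greatest X ⟨q, hq⟩ ⟨1, (one_mul X).symm⟩)

theorem rightDvd_one_of_rightDvd_X_pow {f : SkewPolynomial D} (hf : f.coeff 0 ≠ 0) {k : ℕ}
    (h : f ∣ᵣ X ^ k) : f ∣ᵣ 1 := by
  rw [← mem_leftIdeal_iff] at h ⊢
  induction k with
  | zero => simpa using h
  | succ k ih =>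
    refine ih ?_
    obtain ⟨q, hq⟩ := exists_eq_mul_X_add_C f
    obtain ⟨q', hq'⟩ : ∃ q', X ^ k * q = q' * X ^ k := ⟨_, X_pow_mul⟩
    have hC : C (φ^[k] (f.coeff 0)) * X ^ k ∈ leftIdeal f := by
      have hsub : C (φ^[k] (f.coeff 0)) * X ^ k = X ^ k * f - q' * X ^ (k + 1) := by
        conv_rhs => rw [hq]
        rw [mul_add, ← mul_assoc, hq', X_pow_mul_C, mul_assoc, ← pow_succ, add_sub_cancel_left]
      rw [hsub]
      exact sub_mem (Ideal.mul_mem_left _ _ (Ideal.mem_span_singleton_self f))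
        (Ideal.mul_mem_left _ _ h)
    have := Ideal.mul_mem_left _ (C (φ^[k] (f.coeff 0))⁻¹) hC
    rwa [← mul_assoc, ← C_mul, inv_mul_cancel₀ (iterate_φ_ne_zero k hf), C_1, one_mul] at this

end Division

section InnerOrder

variable {D : Type*} [DivisionRing D] [MulSemiringAction (Multiplicative ℕ) D]
  {σ : D ≃+* D} {n : ℕ} {u : Dˣ}

theorem iterate_eq_iterate_φ (hσ : ∀ a : D, σ a = φ a) (i : ℕ) (a : D) : σ^[i] a = φ^[i] a :=
  congrFun (congrArg (·^[i]) (funext hσ : ⇑σ = ⇑(φ (R := D)))) a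

theorem HasInnerOrder.eq_of_intertwines (hσ : ∀ a : D, σ a = φ a) (hn : HasInnerOrder σ n u)
    {i j : ℕ} (hi : i < n) (hj : j < n) {c : D} (hc : c ≠ 0)
    (h : ∀ b, c * φ^[i] b = φ^[j] b * c) : i = j := by
  simp only [← iterate_eq_iterate_φ hσ] at h
  rcases lt_trichotomy i j with hij | hij | hij
  · refine (hn.not_inner (j - i) (by omega) (by omega) (Units.mk0 c hc) fun a ↦ ?_).elim
    obtain ⟨b, rfl⟩ := σ.surjective.iterate i a
    rw [← Function.iterate_add_apply, Nat.sub_add_cancel hij.le]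
    simp [h, hc]
  · exact hij
  · refine (hn.not_inner (i - j) (by omega) (by omega) (Units.mk0 c hc)⁻¹ fun a ↦ ?_).elim
    obtain ⟨b, rfl⟩ := σ.surjective.iterate j a
    rw [← Function.iterate_add_apply, Nat.sub_add_cancel hij.le]
    simp [mul_assoc, ← h, hc]

theorem HasInnerOrder.exists_mem_card_support_lt (hσ : ∀ a : D, σ a = φ a)
    (hn : HasInnerOrder σ n u) {S : TwoSidedIdeal (SkewPolynomial D)} {p : SkewPolynomial D}
    (hpS : p ∈ S) (hpn : p ∈ degreeLT D n) {i j : ℕ} (hij : i ≠ j) (hi : p.coeff i ≠ 0)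
    (hj : p.coeff j ≠ 0) :
    ∃ q ∈ S, q ∈ degreeLT D n ∧ q.coeff j ≠ 0 ∧ q.support.card < p.support.card := by
  have lt_n {k : ℕ} (hk : p.coeff k ≠ 0) : k < n := not_le.1 fun h ↦ hk (hpn k h)
  obtain ⟨b, hb⟩ : ∃ b, p.coeff j * φ^[j] b -
      p.coeff i * φ^[i] b * (p.coeff i)⁻¹ * p.coeff j ≠ 0 := by
    by_contra! h
    refine hij (hn.eq_of_intertwines hσ (lt_n hj) (lt_n hi)
      (mul_ne_zero (inv_ne_zero hi) hj) fun b ↦ ?_).symm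
    rw [mul_assoc, sub_eq_zero.1 (h b)]
    simp [mul_assoc, hi]
  let q := p * C b - C (p.coeff i * φ^[i] b * (p.coeff i)⁻¹) * p
  have hq (k : ℕ) : q.coeff k =
      p.coeff k * φ^[k] b - p.coeff i * φ^[i] b * (p.coeff i)⁻¹ * p.coeff k := by
    rw [SkewPolynomial.coeff_sub, coeff_mul_C, coeff_C_mul]
  refine ⟨q, sub_mem (S.mul_mem_right _ _ hpS) (S.mul_mem_left _ _ hpS),
    sub_mem (mul_C_mem_degreeLT hpn _) (C_mul_mem_degreeLT hpn _), hq j ▸ hb,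
    Finset.card_lt_card ((Finset.ssubset_iff_of_subset fun k hk ↦ ?_).2
      ⟨i, mem_support_iff.2 hi, ?_⟩)⟩
  · rw [mem_support_iff, hq] at hk
    exact mem_support_iff.2 fun h ↦ hk (by rw [h, zero_mul, mul_zero, sub_zero])
  · rw [notMem_support_iff, hq, inv_mul_cancel_right₀ hi, sub_self]

theorem HasInnerOrder.X_pow_mem_of_coeff_ne_zero (hσ : ∀ a : D, σ a = φ a)
    (hn : HasInnerOrder σ n u) {S : TwoSidedIdeal (SkewPolynomial D)} {p : SkewPolynomial D}
    (hpS : p ∈ S) (hpn : p ∈ degreeLT D n) {j : ℕ} (hj : p.coeff j ≠ 0) : X ^ j ∈ S := by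
  induction hk : p.support.card using Nat.strong_induction_on generalizing p with
  | _ k ih =>
    by_cases hmono : ∃ i, i ≠ j ∧ p.coeff i ≠ 0
    · obtain ⟨i, hij, hi⟩ := hmono
      obtain ⟨q, hqS, hqn, hqj, hcard⟩ := hn.exists_mem_card_support_lt hσ hpS hpn hij hi hj
      exact ih _ (hk ▸ hcard) hqS hqn hqj rfl
    · push Not at hmono
      have hp : X ^ j = C (p.coeff j)⁻¹ * p := by
        ext i
        rw [coeff_C_mul, X_pow_eq_monomial, coeff_monomial]
        split_ifs with hji
        · rw [← hji, inv_mul_cancel₀ hj]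
        · rw [hmono i (Ne.symm hji), mul_zero]
      exact hp ▸ S.mul_mem_left _ _ hpS

theorem centralVar_eq_monomial : centralVar u n = monomial n ((u⁻¹ : Dˣ) : D) :=
  C_mul_X_pow_eq_monomial (n := n)

theorem HasInnerOrder.centralVar_mem_center (hσ : ∀ a : D, σ a = φ a) (hn : HasInnerOrder σ n u)
    (hu : σ (u : D) = u) : centralVar u n ∈ Subring.center (SkewPolynomial D) := by
  refine Subring.mem_center_iff.2 fun p ↦ ?_
  have hpow (a : D) : φ^[n] a = u * a * ((u⁻¹ : Dˣ) : D) := by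
    rw [← iterate_eq_iterate_φ hσ, hn.pow_eq]
  have hfix (k : ℕ) : φ^[k] ((u⁻¹ : Dˣ) : D) = ((u⁻¹ : Dˣ) : D) := by
    refine Function.iterate_fixed ?_ k
    rw [Units.val_inv_eq_inv_val, map_inv₀, ← hσ, hu]
  rw [centralVar_eq_monomial]
  induction p using SkewPolynomial.induction with
  | h0 => simp
  | ha k a q _ _ ih =>
    rw [mul_add, add_mul, ih, monomial_mul_monomial, monomial_mul_monomial, hpow, hfix,
      add_comm n k, mul_assoc (u : D), Units.inv_mul_cancel_left]

end InnerOrder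

section BaseField

variable {D : Type*} [DivisionRing D]

theorem coe_centerCongr_pow (σ : D ≃+* D) (k : ℕ) (c : Subring.center D) :
    (((Subring.centerCongr σ : RingAut (Subring.center D)) ^ k) c : D) = σ^[k] c := by
  induction k generalizing c with
  | zero => rfl
  | succ k ih =>
    rw [pow_succ, RingAut.mul_apply, ih, Function.iterate_succ_apply]
    rfl

theorem HasInnerOrder.isOfFinOrder_centerCongr {σ : D ≃+* D} {n : ℕ} {u : Dˣ}
    (hn : HasInnerOrder σ n u) :
    IsOfFinOrder (Subring.centerCongr σ : RingAut (Subring.center D)) := by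
  refine isOfFinOrder_iff_pow_eq_one.2 ⟨n, hn.pos, ?_⟩
  ext c
  rw [coe_centerCongr_pow, hn.pow_eq, Subring.mem_center_iff.1 c.2 u, Units.mul_inv_cancel_right]
  rfl

variable [MulSemiringAction (Multiplicative ℕ) D] {σ : D ≃+* D} {n : ℕ} {u : Dˣ}

theorem fixedPoints_subfield_zpowers_centerCongr (hσ : ∀ a : D, σ a = φ a) :
    FixedPoints.subfield
      (Subgroup.zpowers (Subring.centerCongr σ : RingAut (Subring.center D)))
      (Subring.center D) = fixedCenter D := by
  let τ : RingAut (Subring.center D) := Subring.centerCongr σ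
  ext c
  have hc : c ∈ fixedCenter D ↔ τ c = c := by
    change φ (c : D) = c ↔ _
    rw [← hσ, Subtype.ext_iff]
    rfl
  rw [hc]
  refine ⟨fun h ↦ h ⟨τ, Subgroup.mem_zpowers τ⟩, ?_⟩
  rintro h ⟨_, k, rfl⟩
  have hτ : τ ∈ MulAction.stabilizer (RingAut (Subring.center D)) c := h
  exact (Subgroup.zpow_mem _ hτ k :)

theorem HasInnerOrder.finiteDimensional_baseField [FiniteDimensional (Subring.center D) D]
    (hσ : ∀ a : D, σ a = φ a) (hn : HasInnerOrder σ n u) : FiniteDimensional (BaseField D) D := by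
  have : Finite (Subgroup.zpowers (Subring.centerCongr σ : RingAut (Subring.center D))) :=
    finite_zpowers.2 hn.isOfFinOrder_centerCongr
  have h : FiniteDimensional (FixedPoints.subfield
    (Subgroup.zpowers (Subring.centerCongr σ : RingAut (Subring.center D)))
    (Subring.center D)) (Subring.center D) := inferInstance
  rw [fixedPoints_subfield_zpowers_centerCongr hσ] at h
  exact Module.Finite.trans (R := fixedCenter D) (Subring.center D) D

end BaseField

section CyclicQuotient

variable {D : Type*} [DivisionRing D] [MulSemiringAction (Multiplicative ℕ) D]

/-- The skew polynomial `u⁻¹tⁿ - a`. -/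
def cyclicModulus (u : Dˣ) (n : ℕ) (a : BaseField D) : SkewPolynomial D :=
  centralVar u n - algebraMap (BaseField D) (SkewPolynomial D) a

/-- The quotient `R / R(u⁻¹tⁿ - a)`, a generalised cyclic algebra. It is a ring when `u⁻¹tⁿ - a`
generates a two-sided ideal, which is passed as an instance argument. -/
abbrev CyclicQuotient (u : Dˣ) (n : ℕ) (a : BaseField D) : Type _ :=
  SkewPolynomial D ⧸ leftIdeal (cyclicModulus u n a)

/-- The quotient map `R → R / R(u⁻¹tⁿ - a)`. -/
abbrev cyclicMk (u : Dˣ) (n : ℕ) (a : BaseField D)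
    [(leftIdeal (cyclicModulus u n a)).IsTwoSided] :
    SkewPolynomial D →ₐ[BaseField D] CyclicQuotient u n a :=
  Ideal.Quotient.mkₐ (BaseField D) (leftIdeal (cyclicModulus u n a))

variable {σ : D ≃+* D} {n : ℕ} {u : Dˣ} {a : BaseField D}

theorem cyclicModulus_eq :
    cyclicModulus u n a = monomial n ((u⁻¹ : Dˣ) : D) - C (algebraMap (BaseField D) D a) := by
  rw [cyclicModulus, centralVar_eq_monomial]
  rfl

theorem natDegree_cyclicModulus (hn : 0 < n) : natDegree (cyclicModulus u n a) = n := by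
  refine le_antisymm (Finset.sup_le fun i hi ↦ ?_) (le_natDegree_of_coeff_ne_zero ?_)
  · by_contra! h : n < i
    rw [mem_support_iff, cyclicModulus_eq, SkewPolynomial.coeff_sub, coeff_monomial,
      if_neg h.ne, coeff_C_ne_zero (by omega), sub_zero] at hi
    exact hi rfl
  · rw [cyclicModulus_eq, SkewPolynomial.coeff_sub, coeff_monomial, if_pos rfl,
      coeff_C_ne_zero hn.ne', sub_zero]
    exact u⁻¹.ne_zero

theorem cyclicModulus_ne_zero (hn : 0 < n) : cyclicModulus u n a ≠ 0 := by
  intro h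
  have := natDegree_cyclicModulus (u := u) (a := a) hn
  rw [h] at this
  exact hn.ne this

theorem HasInnerOrder.isTwoSided_leftIdeal_cyclicModulus (hσ : ∀ a : D, σ a = φ a)
    (hn : HasInnerOrder σ n u) (hu : σ (u : D) = u) :
    (leftIdeal (cyclicModulus u n a)).IsTwoSided :=
  isTwoSided_span_singleton_of_mem_center <| sub_mem (hn.centralVar_mem_center hσ hu) <|
    Subring.mem_center_iff.2 fun p ↦ (Algebra.commutes a p).symm

theorem finiteDimensional_cyclicQuotient [FiniteDimensional (BaseField D) D]
    [(leftIdeal (cyclicModulus u n a)).IsTwoSided] (hn : 0 < n) :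
    FiniteDimensional (BaseField D) (CyclicQuotient u n a) := by
  have := finite_quotient_leftIdeal (cyclicModulus_ne_zero (u := u) (a := a) hn)
  exact Module.Finite.trans D _

theorem nontrivial_cyclicQuotient (hn : 0 < n) : Nontrivial (CyclicQuotient u n a) :=
  Ideal.Quotient.nontrivial_iff.2 fun h ↦
    not_rightDvd_one ((natDegree_cyclicModulus (u := u) (a := a) hn).symm ▸ hn)
      (mem_leftIdeal_iff.1 ((Ideal.eq_top_iff_one _).1 h))

theorem HasInnerOrder.exists_mem_center_eq_C (hσ : ∀ a : D, σ a = φ a)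
    (hn : HasInnerOrder σ n u) {r : SkewPolynomial D} (hr : r ∈ degreeLT D n)
    (hcomm : ∀ b, C b * r = r * C b) : ∃ c ∈ Subring.center D, r = C c := by
  have hcoeff (b : D) (i : ℕ) : b * r.coeff i = r.coeff i * φ^[i] b := by
    rw [← coeff_C_mul, hcomm, coeff_mul_C]
  refine ⟨r.coeff 0, Subring.mem_center_iff.2 fun b ↦ hcoeff b 0, ?_⟩
  ext i
  rcases eq_or_ne i 0 with rfl | hi
  · rw [coeff_C_zero]
  · rw [coeff_C_ne_zero hi]
    by_contra h
    have hin : i < n := not_le.1 fun hni ↦ h (hr i hni)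
    exact hi (hn.eq_of_intertwines hσ hin hn.pos h fun b ↦ (hcoeff b i).symm)

variable [(leftIdeal (cyclicModulus u n a)).IsTwoSided]

theorem exists_mem_degreeLT_cyclicMk_eq (hn : 0 < n) (x : CyclicQuotient u n a) :
    ∃ r ∈ degreeLT D n, cyclicMk u n a r = x := by
  obtain ⟨p, rfl⟩ := Ideal.Quotient.mk_surjective x
  obtain ⟨r, hr, hpr⟩ :=
    exists_mem_degreeLT_sub_mem_leftIdeal (cyclicModulus_ne_zero (u := u) (a := a) hn) p
  exact ⟨r, natDegree_cyclicModulus (u := u) (a := a) hn ▸ hr, (Ideal.Quotient.eq.2 hpr).symm⟩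

theorem eq_zero_of_cyclicMk_eq_zero (hn : 0 < n) {r : SkewPolynomial D}
    (hr : r ∈ degreeLT D n) (h : cyclicMk u n a r = 0) : r = 0 :=
  eq_zero_of_mem_leftIdeal_of_mem_degreeLT (Ideal.Quotient.eq_zero_iff_mem.1 h)
    ((natDegree_cyclicModulus (u := u) (a := a) hn).symm ▸ hr)

theorem cyclicMk_X_pow :
    cyclicMk u n a (X ^ n) = cyclicMk u n a (C (u * algebraMap (BaseField D) D a)) := by
  refine Ideal.Quotient.eq.2 (Ideal.mem_span_singleton'.2 ⟨C (u : D), ?_⟩)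
  rw [cyclicModulus_eq, mul_sub, C_mul_monomial, Units.mul_inv, X_pow_eq_monomial, C_mul]

theorem isUnit_cyclicMk_X (hn : 0 < n) (ha : a ≠ 0) : IsUnit (cyclicMk u n a X) := by
  rw [← isUnit_pow_iff hn.ne', ← map_pow, cyclicMk_X_pow]
  have hunit : IsUnit (u * algebraMap (BaseField D) D a : D) :=
    (mul_ne_zero u.ne_zero ((map_ne_zero _).2 ha)).isUnit
  exact (hunit.map CRingHom).map (cyclicMk u n a)

theorem HasInnerOrder.isSimpleRing_cyclicQuotient (hσ : ∀ a : D, σ a = φ a)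
    (hn : HasInnerOrder σ n u) (ha : a ≠ 0) : IsSimpleRing (CyclicQuotient u n a) := by
  have := nontrivial_cyclicQuotient (u := u) (a := a) hn.pos
  refine .of_eq_bot_or_eq_top fun J ↦ ?_
  rw [or_iff_not_imp_left, ← J.one_mem_iff]
  intro hJ
  obtain ⟨x, hxJ, hx0 : x ≠ 0⟩ := SetLike.exists_of_lt (bot_lt_iff_ne_bot.2 hJ)
  obtain ⟨r, hr, rfl⟩ := exists_mem_degreeLT_cyclicMk_eq hn.pos x
  obtain ⟨j, hj⟩ : ∃ j, r.coeff j ≠ 0 := by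
    by_contra! h
    exact hx0 (by rw [show r = 0 by ext i; exact h i, map_zero])
  have hX : X ^ j ∈ J.comap (cyclicMk u n a) :=
    hn.X_pow_mem_of_coeff_ne_zero hσ ((TwoSidedIdeal.mem_comap _).2 hxJ) hr hj
  rw [TwoSidedIdeal.mem_comap, map_pow] at hX
  obtain ⟨y, hy⟩ := ((isUnit_cyclicMk_X (u := u) hn.pos ha).pow j).exists_left_inv
  rw [← hy]
  exact J.mul_mem_left y _ hX

theorem HasInnerOrder.isCentral_cyclicQuotient (hσ : ∀ a : D, σ a = φ a)
    (hn : HasInnerOrder σ n u) (ha : a ≠ 0) :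
    Algebra.IsCentral (BaseField D) (CyclicQuotient u n a) := by
  refine ⟨fun x hx ↦ ?_⟩
  rw [Subalgebra.mem_center_iff] at hx
  obtain ⟨r, hr, rfl⟩ := exists_mem_degreeLT_cyclicMk_eq hn.pos x
  have hcomm (b : D) : C b * r = r * C b := by
    refine sub_eq_zero.1 (eq_zero_of_cyclicMk_eq_zero (u := u) (a := a) hn.pos
      (sub_mem (C_mul_mem_degreeLT hr b) (mul_C_mem_degreeLT hr b)) ?_)
    rw [map_sub, map_mul, map_mul, hx, sub_self]
  obtain ⟨c, hc, rfl⟩ := hn.exists_mem_center_eq_C hσ hr hcomm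
  have hfix : φ c = c := by
    have hmul : cyclicMk u n a (C (φ c - c)) * cyclicMk u n a X = 0 := by
      have hXC : (X * C c : SkewPolynomial D) = C (φ c) * X := by simpa using X_pow_mul_C 1 c
      rw [← map_mul, C_sub, sub_mul, ← hXC, map_sub, map_mul, map_mul, hx, sub_self]
    have hC := eq_zero_of_cyclicMk_eq_zero (u := u) (a := a) hn.pos
      (fun i hi ↦ coeff_C_ne_zero (hn.pos.trans_le hi).ne')
      ((isUnit_cyclicMk_X hn.pos ha).mul_left_eq_zero.1 hmul)
    rwa [C_eq_zero, sub_eq_zero] at hC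
  exact Algebra.mem_bot.2 ⟨(⟨⟨c, hc⟩, hfix⟩ : fixedCenter D), rfl⟩

end CyclicQuotient

section Eigenring

variable {D : Type*} [DivisionRing D] [MulSemiringAction (Multiplicative ℕ) D]
  {f : SkewPolynomial D}

/-- The quotient map from the idealiser of `f` to its eigenring. -/
def eigenringMk (f : SkewPolynomial D) : idealiser f →ₐ[BaseField D] Eigenring f :=
  Ideal.Quotient.mkₐ (BaseField D) (idealiserIdeal f)

theorem eigenringMk_surjective : Function.Surjective (eigenringMk f) :=
  Ideal.Quotient.mkₐ_surjective _ _

theorem eigenringMk_eq_zero_iff {g : idealiser f} :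
    eigenringMk f g = 0 ↔ (g : SkewPolynomial D) ∈ leftIdeal f :=
  Ideal.Quotient.eq_zero_iff_mem

section Corner

variable {A Φ : Type*} [Ring A] [FunLike Φ (SkewPolynomial D) A]
  [RingHomClass Φ (SkewPolynomial D) A] {π : Φ} {e : A}

theorem idempotent_mul_map_mul (hπ : Function.Surjective π) (he : IsIdempotentElem e)
    (hfe : ∀ p, p ∈ leftIdeal f ↔ π p * e = 0) (g : idealiser f) :
    e * π g * e = π g * e := by
  obtain ⟨p, hp⟩ := hπ (1 - e)
  obtain ⟨q, rfl⟩ := Ideal.mem_span_singleton'.1 ((hfe p).2 (by rw [hp, he.one_sub_mul_self]))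
  have h : (1 - e) * π g * e = 0 := by
    rw [← hp, ← map_mul, ← hfe, mul_assoc]
    exact Ideal.mul_mem_left _ _ g.2
  rw [sub_mul, sub_mul, one_mul, sub_eq_zero] at h
  exact h.symm

/-- The compression `g ↦ e π(g) e`, which is multiplicative on the idealiser of `f` when `Rf` is the
preimage under `π` of the left annihilator of the idempotent `e`. -/
def idealiserToCorner (hπ : Function.Surjective π) (he : IsIdempotentElem e)
    (hfe : ∀ p, p ∈ leftIdeal f ↔ π p * e = 0) : idealiser f →+* he.Corner where
  toFun g := toCorner he (π g)
  map_one' := cornerSubtype_injective (by simp [he.eq])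
  map_mul' g g' := cornerSubtype_injective <| by
    simp only [map_mul, MulMemClass.coe_mul, cornerSubtype_toCorner]
    rw [idempotent_mul_map_mul hπ he hfe g', ← mul_assoc e, mul_assoc _ e, ← mul_assoc e,
      idempotent_mul_map_mul hπ he hfe g', mul_assoc]
  map_zero' := cornerSubtype_injective (by simp)
  map_add' g g' := cornerSubtype_injective (by simp [mul_add, add_mul])

variable (hπ : Function.Surjective π) (he : IsIdempotentElem e)
  (hfe : ∀ p, p ∈ leftIdeal f ↔ π p * e = 0)

theorem cornerSubtype_idealiserToCorner (g : idealiser f) :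
    cornerSubtype he (idealiserToCorner hπ he hfe g) = π g * e :=
  idempotent_mul_map_mul hπ he hfe g

theorem idealiserToCorner_surjective : Function.Surjective (idealiserToCorner hπ he hfe) := by
  intro x
  obtain ⟨g, hg⟩ := hπ (cornerSubtype he x)
  have hgf : g ∈ idealiser f := by
    have hf : π f * e = 0 := (hfe f).1 (Ideal.mem_span_singleton_self f)
    refine (hfe _).2 ?_
    rw [map_mul, hg, mul_assoc, cornerSubtype_mul_idempotent, ← idempotent_mul_cornerSubtype,
      ← mul_assoc, hf, zero_mul]
  refine ⟨⟨g, hgf⟩, cornerSubtype_injective ?_⟩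
  rw [cornerSubtype_idealiserToCorner, hg, cornerSubtype_mul_idempotent]

theorem ker_idealiserToCorner : RingHom.ker (idealiserToCorner hπ he hfe) = idealiserIdeal f := by
  ext g
  rw [RingHom.mem_ker, ← map_eq_zero_iff _ cornerSubtype_injective,
    cornerSubtype_idealiserToCorner, ← hfe]
  rfl

/-- If `Rf` is the preimage under `π` of the left annihilator of the idempotent `e`, then the
eigenring of `f` is the corner ring of `e`. -/
def eigenringEquivCorner : Eigenring f ≃+* he.Corner :=
  (Ideal.quotEquivOfEq (ker_idealiserToCorner hπ he hfe).symm).trans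
    (RingHom.quotientKerEquivOfSurjective (idealiserToCorner_surjective hπ he hfe))

theorem cornerSubtype_eigenringEquivCorner (g : idealiser f) :
    cornerSubtype he (eigenringEquivCorner hπ he hfe (eigenringMk f g)) = π g * e :=
  cornerSubtype_idealiserToCorner hπ he hfe g

end Corner

section CentralSimple

variable {A : Type*} [Ring A] [Algebra (BaseField D) A] {π : SkewPolynomial D →ₐ[BaseField D] A}
  {e : A}

theorem exists_isIdempotentElem_mem_leftIdeal_iff [IsSemisimpleRing A]
    (hπ : Function.Surjective π) (hker : RingHom.ker π ≤ leftIdeal f) :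
    ∃ e, IsIdempotentElem e ∧ ∀ p, p ∈ leftIdeal f ↔ π p * e = 0 := by
  obtain ⟨e, he, hIe⟩ := exists_isIdempotentElem_forall_mem_iff ((leftIdeal f).map π)
  refine ⟨e, he, fun p ↦ ?_⟩
  rw [← hIe, ← Ideal.mem_comap, Ideal.comap_map_of_surjective' _ hπ, sup_of_le_left hker]

theorem cornerSubtype_eigenringEquivCorner_algebraMap (hπ : Function.Surjective π)
    (he : IsIdempotentElem e) (hfe : ∀ p, p ∈ leftIdeal f ↔ π p * e = 0) (c : BaseField D) :
    cornerSubtype he (eigenringEquivCorner hπ he hfe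
      (algebraMap (BaseField D) (Eigenring f) c)) = algebraMap (BaseField D) A c * e := by
  rw [← (eigenringMk f).commutes, cornerSubtype_eigenringEquivCorner]
  exact congrArg (· * e) (π.commutes c)

theorem finiteDimensional_eigenring [FiniteDimensional (BaseField D) A]
    (hπ : Function.Surjective π) (he : IsIdempotentElem e)
    (hfe : ∀ p, p ∈ leftIdeal f ↔ π p * e = 0) :
    FiniteDimensional (BaseField D) (Eigenring f) := by
  let ε := eigenringEquivCorner hπ he hfe
  let ψ : Eigenring f →ₗ[BaseField D] A :=
    { toFun y := cornerSubtype he (ε y)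
      map_add' _ _ := by rw [map_add, map_add]
      map_smul' c y := by
        rw [Algebra.smul_def, map_mul, map_mul, cornerSubtype_eigenringEquivCorner_algebraMap,
          mul_assoc, idempotent_mul_cornerSubtype, RingHom.id_apply, Algebra.smul_def] }
  exact Module.Finite.of_injective ψ (cornerSubtype_injective.comp ε.injective)

theorem isCentral_eigenring [IsSimpleRing A] [Algebra.IsCentral (BaseField D) A]
    (hπ : Function.Surjective π) (he : IsIdempotentElem e) (he0 : e ≠ 0)
    (hfe : ∀ p, p ∈ leftIdeal f ↔ π p * e = 0) :
    Algebra.IsCentral (BaseField D) (Eigenring f) := by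
  let ε := eigenringEquivCorner hπ he hfe
  refine ⟨fun z hz ↦ ?_⟩
  have hεz : ε z ∈ Subring.center he.Corner := Subring.mem_center_iff.2 fun y ↦ by
    rw [← ε.apply_symm_apply y, ← map_mul, ← map_mul, Subalgebra.mem_center_iff.1 hz]
  obtain ⟨w, hw, hzw⟩ := exists_mem_center_mul_eq_of_mem_center_corner he0 hεz
  obtain ⟨c, rfl⟩ := Algebra.mem_bot.1 (Algebra.IsCentral.out (K := BaseField D)
    (Subalgebra.mem_center_iff.2 (Subring.mem_center_iff.1 hw)))
  refine Algebra.mem_bot.2 ⟨c, ε.injective (cornerSubtype_injective ?_)⟩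
  rw [cornerSubtype_eigenringEquivCorner_algebraMap, hzw]

theorem isGeneralisedAPolynomial_of_surjective [IsSimpleRing A]
    [Algebra.IsCentral (BaseField D) A] [FiniteDimensional (BaseField D) A]
    (hπ : Function.Surjective π) (hker : RingHom.ker π ≤ leftIdeal f) (hf : ¬ f ∣ᵣ 1) :
    IsGeneralisedAPolynomial f := by
  have : IsArtinianRing A := .of_finite (BaseField D) A
  have : IsSemisimpleRing A := IsSimpleRing.isSemisimpleRing_iff_isArtinianRing.2 this
  obtain ⟨e, he, hfe⟩ := exists_isIdempotentElem_mem_leftIdeal_iff hπ hker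
  have he0 : e ≠ 0 := by
    rintro rfl
    exact hf (mem_leftIdeal_iff.1 ((hfe 1).2 (mul_zero _)))
  have := isSimpleRing_corner he he0
  exact ⟨isCentral_eigenring hπ he he0 hfe,
    .of_ringEquiv (eigenringEquivCorner hπ he hfe).symm this,
    finiteDimensional_eigenring hπ he hfe⟩

end CentralSimple

variable {σ : D ≃+* D} {n : ℕ} {u : Dˣ} {a : BaseField D}

theorem HasInnerOrder.isGeneralisedAPolynomial_of_rightDvd [FiniteDimensional (Subring.center D) D]
    (hσ : ∀ a : D, σ a = φ a) (hn : HasInnerOrder σ n u) (hu : σ (u : D) = u) (ha : a ≠ 0)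
    (hf : f ∣ᵣ cyclicModulus u n a) (hf1 : ¬ f ∣ᵣ 1) : IsGeneralisedAPolynomial f := by
  have := hn.isTwoSided_leftIdeal_cyclicModulus (a := a) hσ hu
  have := hn.finiteDimensional_baseField hσ
  have := finiteDimensional_cyclicQuotient (u := u) (a := a) hn.pos
  have := hn.isSimpleRing_cyclicQuotient hσ ha
  have := hn.isCentral_cyclicQuotient hσ ha
  refine isGeneralisedAPolynomial_of_surjective (π := cyclicMk u n a)
    (Ideal.Quotient.mkₐ_surjective _ _) ?_ hf1
  exact (Ideal.Quotient.mkₐ_ker (BaseField D) _).le.trans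
    ((Ideal.span_singleton_le_iff_mem _).2 (mem_leftIdeal_iff.2 hf))

theorem exists_rightDvd_sub_algebraMap_of_mem_center
    [Algebra.IsCentral (BaseField D) (Eigenring f)] {z : SkewPolynomial D}
    (hz : z ∈ Subring.center (SkewPolynomial D)) :
    ∃ a, f ∣ᵣ z - algebraMap (BaseField D) (SkewPolynomial D) a := by
  rw [Subring.mem_center_iff] at hz
  have hmem : z ∈ idealiser f := mem_leftIdeal_iff.2 ⟨z, hz f⟩
  have hcenter : eigenringMk f ⟨z, hmem⟩ ∈ Subalgebra.center (BaseField D) (Eigenring f) := by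
    refine Subalgebra.mem_center_iff.2 fun y ↦ ?_
    obtain ⟨g, rfl⟩ := eigenringMk_surjective y
    rw [← map_mul, ← map_mul]
    exact congrArg _ (Subtype.ext (hz g))
  obtain ⟨a, ha⟩ := Algebra.mem_bot.1 (Algebra.IsCentral.out (K := BaseField D) hcenter)
  refine ⟨a, mem_leftIdeal_iff.1 ((eigenringMk_eq_zero_iff
    (g := ⟨z, hmem⟩ - algebraMap (BaseField D) (idealiser f) a)).1 ?_)⟩
  rw [map_sub, ← ha, AlgHom.commutes, sub_self]

theorem ne_zero_of_rightDvd_cyclicModulus (hf0 : f.coeff 0 ≠ 0) (hf1 : ¬ f ∣ᵣ 1)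
    (hf : f ∣ᵣ cyclicModulus u n a) : a ≠ 0 := by
  rintro rfl
  refine hf1 (rightDvd_one_of_rightDvd_X_pow hf0 (k := n) (mem_leftIdeal_iff.1 ?_))
  have hX : (X ^ n : SkewPolynomial D) = C (u : D) * cyclicModulus u n 0 := by
    rw [cyclicModulus_eq, map_zero, C_0, sub_zero, C_mul_monomial, Units.mul_inv, X_pow_eq_monomial]
  rw [hX]
  exact Ideal.mul_mem_left _ _ (mem_leftIdeal_iff.2 hf)

theorem HasInnerOrder.isGeneralisedAPolynomial_iff_exists_rightDvd
    [FiniteDimensional (Subring.center D) D] (hσ : ∀ a : D, σ a = φ a)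
    (hn : HasInnerOrder σ n u) (hu : σ (u : D) = u) (hf0 : f.coeff 0 ≠ 0) (hf1 : ¬ f ∣ᵣ 1) :
    IsGeneralisedAPolynomial f ↔ ∃ a : BaseField D, f ∣ᵣ cyclicModulus u n a := by
  constructor
  · intro h
    have := h.central
    exact exists_rightDvd_sub_algebraMap_of_mem_center (hn.centralVar_mem_center hσ hu)
  · rintro ⟨a, ha⟩
    exact hn.isGeneralisedAPolynomial_of_rightDvd hσ hu
      (ne_zero_of_rightDvd_cyclicModulus hf0 hf1 ha) ha hf1

end Eigenring

end SkewEigen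

end

theorem theorem3 {D : Type*} [DivisionRing D] [MulSemiringAction (Multiplicative ℕ) D]
    (d : ℕ) [FiniteDimensional (Subring.center D) D]
    (hd : Module.finrank (Subring.center D) D = d ^ 2)
    (σ : D ≃+* D) (hσ : ∀ a : D, σ a = SkewPolynomial.φ a)
    (n : ℕ) (u : Dˣ) (hn : SkewEigen.HasInnerOrder σ n u) (hu : σ (u : D) = u)
    (f : SkewPolynomial D) (hf : SkewEigen.IsMonic f) (hm : 1 ≤ SkewEigen.natDegree f)
    (hft : SkewEigen.IsGCRD 1 f SkewPolynomial.X)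
    (hhat : Polynomial (SkewEigen.BaseField D))
    (hh : SkewEigen.IsMinCentralLeftMultiple u n f hhat)
    (hirr : Irreducible hhat) :
    (SkewEigen.IsGeneralisedAPolynomial f ↔
      ∃ a : SkewEigen.BaseField D, hhat = Polynomial.X - Polynomial.C a) ∧
    ((∃ a : SkewEigen.BaseField D, hhat = Polynomial.X - Polynomial.C a) ↔
      ∃ a : SkewEigen.BaseField D, f ∣ᵣ
        (SkewPolynomial.C ((u⁻¹ : Dˣ) : D) * SkewPolynomial.X ^ n
          - SkewPolynomial.C (algebraMap (SkewEigen.BaseField D) D a))) ∧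
    (SkewEigen.IsGeneralisedAPolynomial f → SkewEigen.natDegree f ≤ n) := by
  have hf1 : ¬ f ∣ᵣ 1 := SkewEigen.not_rightDvd_one hm
  have hproper : SkewEigen.leftIdeal f ≠ ⊤ := fun h ↦
    hf1 (SkewEigen.mem_leftIdeal_iff.1 ((Ideal.eq_top_iff_one _).1 h))
  have hhat_iff (a : SkewEigen.BaseField D) :
      hhat = Polynomial.X - Polynomial.C a ↔ f ∣ᵣ SkewEigen.cyclicModulus u n a :=
    (SkewEigen.eq_X_sub_C_iff_sub_algebraMap_mem hproper hh.monic hirr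
      (SkewEigen.mem_leftIdeal_iff.2 hh.dvd) a).trans SkewEigen.mem_leftIdeal_iff
  have hgen_iff : SkewEigen.IsGeneralisedAPolynomial f ↔
      ∃ a : SkewEigen.BaseField D, f ∣ᵣ SkewEigen.cyclicModulus u n a :=
    hn.isGeneralisedAPolynomial_iff_exists_rightDvd hσ hu
      (SkewEigen.coeff_zero_ne_zero_of_isGCRD_one_X hft) hf1
  refine ⟨hgen_iff.trans (exists_congr hhat_iff).symm, exists_congr hhat_iff, fun h ↦ ?_⟩
  obtain ⟨a, ha⟩ := hgen_iff.1 h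
  rw [← SkewEigen.natDegree_cyclicModulus (u := u) (a := a) hn.pos]
  exact SkewEigen.natDegree_le_of_rightDvd (SkewEigen.cyclicModulus_ne_zero hn.pos) ha
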